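/- Let $p$ be a prime, $n \ge 1$, $q = p^n$, and let $F_q$ be a finite field with $q$ elements. Let $QD_{32} = \langle a, x \mid a^{16} = x^2 = 1,\ xax = a^7\rangle$ be the quasidihedral group of order $32$, let $F_q[QD_{32}]$ be its group algebra over $F_q$, let $U = U(F_q[QD_{32}])$ be the unit group of this algebra, and let $V_1 = 1 + J(F_q[QD_{32}]) \le U$, where $J$ denotes the Jacobson radical. Write $C_m$ for the cyclic group of order $m$. 1. If $p = 2$ (so $q = 2^n$), then (a) $U/V_1 \cong C_{q-1}$; (b) $V_1$ is a $2$-group of order $2^{31n}$ and exponent $16$. 2. If $p > 2$, then (a) $U \cong C_{q-1}^4 \times GL(2,F_q)^7$ if $q \equiv 1$ or $7 \pmod{16}$; (b) $U \cong C_{q-1}^4 \times GL(2,F_q)^3 \times GL(2,F_{q^2})^2$ if $q \equiv -1$ or $-7 \pmod{16}$; (c) $U \cong C_{q-1}^4 \times GL(2,F_q) \times GL(2,F_{q^2}) \times GL(2,F_{q^4})$ if $q \equiv \pm 3$ or $\pm 5 \pmod{16}$. -/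

import Mathlib

/-- The defining relators of the quasidihedral group of order `32`, on the two generators
`a = FreeGroup.of 0` and `x = FreeGroup.of 1`: the relations are
`a ^ 16 = 1`, `x ^ 2 = 1` and `x * a * x = a ^ 7`. -/
def quasidihedralRels : Set (FreeGroup (Fin 2)) :=
  {FreeGroup.of 0 ^ 16,
   FreeGroup.of 1 ^ 2,
   FreeGroup.of 1 * FreeGroup.of 0 * FreeGroup.of 1 * (FreeGroup.of 0 ^ 7)⁻¹}

/-- The quasidihedral group of order `32`,
`⟨a, x | a ^ 16 = x ^ 2 = 1, x * a * x = a ^ 7⟩`. -/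
abbrev QuasidihedralThirtyTwo : Type := PresentedGroup quasidihedralRels

/-- The subgroup `1 + J(A)` of the unit group of a (not necessarily commutative) ring `A`,
where `J(A)` is the Jacobson radical. -/
def oneAddJacobson (A : Type*) [Ring A] : Subgroup Aˣ where
  carrier := {u | ∃ j ∈ Ring.jacobson A, (u : A) = 1 + j}
  one_mem' := ⟨0, zero_mem _, by simp⟩
  mul_mem' := by
    rintro u v ⟨i, hi, hu⟩ ⟨j, hj, hv⟩
    refine ⟨i + (u : A) * j, add_mem hi (Ideal.mul_mem_left _ _ hj), ?_⟩
    rw [Units.val_mul, hv, mul_add, mul_one, ← add_assoc, ← hu]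
  inv_mem' := by
    rintro u ⟨i, hi, hu⟩
    refine ⟨-((u⁻¹ : Aˣ) : A) * i, Ideal.mul_mem_left _ _ hi, ?_⟩
    have h : ((u⁻¹ : Aˣ) : A) * (1 + i) = 1 := by rw [← hu]; simp
    rw [mul_add, mul_one] at h
    rw [neg_mul, ← sub_eq_add_neg]
    exact eq_sub_of_add_eq h

instance oneAddJacobson_normal (A : Type*) [Ring A] : (oneAddJacobson A).Normal where
  conj_mem := by
    rintro u ⟨i, hi, hu⟩ g
    refine ⟨(g : A) * i * ((g⁻¹ : Aˣ) : A),
      Ideal.mul_mem_right _ _ (Ideal.mul_mem_left _ _ hi), ?_⟩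
    rw [Units.val_mul, Units.val_mul, hu]
    simp [mul_add, add_mul]

section Auxiliary

open Polynomial IntermediateField

namespace QuasidihedralThirtyTwo

/-- The rotation generator of `QD₃₂`. -/
def a : QuasidihedralThirtyTwo := PresentedGroup.of 0

/-- The reflection generator of `QD₃₂`. -/
def x : QuasidihedralThirtyTwo := PresentedGroup.of 1

theorem a_pow : a ^ 16 = 1 := by
  have h := PresentedGroup.one_of_mem (rels := quasidihedralRels) (x := FreeGroup.of 0 ^ 16)
    (by simp [quasidihedralRels])
  rwa [map_pow] at h

theorem x_sq : x ^ 2 = 1 := by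
  have h := PresentedGroup.one_of_mem (rels := quasidihedralRels) (x := FreeGroup.of 1 ^ 2)
    (by simp [quasidihedralRels])
  rwa [map_pow] at h

theorem x_mul_a_mul_x : x * a * x = a ^ 7 := by
  have h := PresentedGroup.one_of_mem (rels := quasidihedralRels)
    (x := FreeGroup.of 1 * FreeGroup.of 0 * FreeGroup.of 1 * (FreeGroup.of 0 ^ 7)⁻¹)
    (by simp [quasidihedralRels])
  rw [map_mul, map_inv, mul_inv_eq_one, map_pow] at h
  rw [map_mul, map_mul] at h
  exact h

theorem x_mul_x : x * x = 1 := by rw [← sq, x_sq]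

theorem x_mul_a : x * a = a ^ 7 * x := by
  rw [← x_mul_a_mul_x, mul_assoc _ x x, x_mul_x, mul_one]

/-- The universal property of `QD₃₂`, for monoids as targets. -/
def lift {M : Type*} [Monoid M] (A X : M) (hA : A ^ 16 = 1) (hX : X ^ 2 = 1)
    (hXA : X * A * X = A ^ 7) : QuasidihedralThirtyTwo →* M :=
  (Units.coeHom M).comp <| PresentedGroup.toGroup
    (f := ![Units.ofPowEqOne A 16 hA (by norm_num), Units.ofPowEqOne X 2 hX (by norm_num)]) <| by
      intro r hr
      rcases hr with rfl | rfl | rfl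
      · ext; simp
      · ext; simp
      · rw [map_mul, map_inv, mul_inv_eq_one]
        ext; simp [hXA]

section lift

variable {M : Type*} [Monoid M] (A X : M) (hA : A ^ 16 = 1) (hX : X ^ 2 = 1)
    (hXA : X * A * X = A ^ 7)

@[simp]
theorem lift_a : lift A X hA hX hXA a = A := by simp [lift, a]

@[simp]
theorem lift_x : lift A X hA hX hXA x = X := by simp [lift, x]

end lift

theorem x_mul_a_pow (i : ℕ) : x * a ^ i = a ^ (7 * i) * x := by
  induction i with
  | zero => simp
  | succ i ih => rw [pow_succ, ← mul_assoc, ih, mul_assoc, x_mul_a, ← mul_assoc, ← pow_add,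
      mul_add, mul_one]

theorem exists_normal_form (g : QuasidihedralThirtyTwo) :
    ∃ i j : ℕ, i < 16 ∧ j < 2 ∧ g = a ^ i * x ^ j := by
  suffices ∃ i j : ℕ, g = a ^ i * x ^ j by
    obtain ⟨i, j, rfl⟩ := this
    exact ⟨i % 16, j % 2, Nat.mod_lt _ (by norm_num), Nat.mod_lt _ (by norm_num),
      by rw [← pow_eq_pow_mod i a_pow, ← pow_eq_pow_mod j x_sq]⟩
  have hmul (i : ℕ) : ∀ j k l : ℕ, ∃ m n, a ^ i * x ^ j * (a ^ k * x ^ l) = a ^ m * x ^ n := by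
    intro j
    induction j with
    | zero => exact fun k l => ⟨i + k, l, by simp [pow_add, mul_assoc]⟩
    | succ j ih =>
      intro k l
      obtain ⟨m, n, h⟩ := ih (7 * k) (l + 1)
      refine ⟨m, n, ?_⟩
      rw [← h, pow_succ x j, pow_succ' x l]
      simp only [mul_assoc]
      rw [← mul_assoc x (a ^ k), x_mul_a_pow, mul_assoc]
  let H : Subgroup QuasidihedralThirtyTwo :=
    { carrier := {g | ∃ i j : ℕ, g = a ^ i * x ^ j}
      one_mem' := ⟨0, 0, by simp⟩
      mul_mem' := by
        rintro _ _ ⟨i, j, rfl⟩ ⟨k, l, rfl⟩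
        exact hmul i j k l
      inv_mem' := by
        rintro _ ⟨i, j, rfl⟩
        obtain ⟨m, n, h⟩ := hmul 0 j (15 * i) 0
        refine ⟨m, n, ?_⟩
        rw [← h, mul_inv_rev]
        have h1 : (a ^ i)⁻¹ = a ^ (15 * i) :=
          inv_eq_of_mul_eq_one_right (by
            rw [← pow_add, show i + 15 * i = 16 * i by ring, pow_mul, a_pow, one_pow])
        have h2 : (x ^ j)⁻¹ = x ^ j :=
          inv_eq_of_mul_eq_one_right (by
            rw [← pow_add, ← two_mul, pow_mul, x_sq, one_pow])
        simp [h1, h2] }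
  refine PresentedGroup.generated_by _ H (fun j => ?_) g
  fin_cases j
  · exact ⟨1, 0, by simp [a]⟩
  · exact ⟨0, 1, by simp [x]⟩

/-- The faithful action of `QD₃₂` on `ℤ/16` by affine maps. -/
def affineHom : QuasidihedralThirtyTwo →* (Function.End (ZMod 16)) :=
  lift (M := Function.End (ZMod 16)) (fun k => k + 1) (fun k => 7 * k)
    (by funext k; revert k; decide) (by funext k; revert k; decide)
    (by funext k; revert k; decide)

theorem affineHom_a (k : ZMod 16) : affineHom a k = k + 1 :=
  congrFun (lift_a (M := Function.End (ZMod 16)) _ _ _ _ _) k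

theorem affineHom_x (k : ZMod 16) : affineHom x k = 7 * k :=
  congrFun (lift_x (M := Function.End (ZMod 16)) _ _ _ _ _) k

theorem affineHom_apply (i j : ℕ) (k : ZMod 16) :
    affineHom (a ^ i * x ^ j) k = 7 ^ j * k + i := by
  have ha (m : ZMod 16) : affineHom (a ^ i) m = m + i := by
    induction i with
    | zero => simp; rfl
    | succ i ih =>
      rw [pow_succ', map_mul]
      change affineHom a (affineHom (a ^ i) m) = _
      rw [ih, affineHom_a]
      push_cast
      ring
  have hx (m : ZMod 16) : affineHom (x ^ j) m = 7 ^ j * m := by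
    induction j with
    | zero => simp; rfl
    | succ j ih =>
      rw [pow_succ', map_mul]
      change affineHom x (affineHom (x ^ j) m) = _
      rw [ih, affineHom_x]
      ring
  rw [map_mul]
  change affineHom (a ^ i) (affineHom (x ^ j) k) = _
  rw [hx, ha]

theorem normal_form_bijective : Function.Bijective
    (fun p : Fin 16 × Fin 2 => a ^ (p.1 : ℕ) * x ^ (p.2 : ℕ)) := by
  constructor
  · intro p r h
    obtain ⟨⟨i, hi⟩, j⟩ := p
    obtain ⟨⟨k, hk⟩, l⟩ := r
    have h0 := congrArg (fun g => affineHom g 0) h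
    have h1 := congrArg (fun g => affineHom g 1) h
    simp only [affineHom_apply, mul_zero, zero_add, mul_one] at h0 h1
    have hik : i = k := by
      have := congrArg ZMod.val h0
      rwa [ZMod.val_cast_of_lt hi, ZMod.val_cast_of_lt hk] at this
    subst hik
    have hjl : j = l := by
      rw [add_left_inj] at h1
      clear h h0
      revert j l
      decide
    rw [hjl]
  · intro g
    obtain ⟨i, j, hi, hj, rfl⟩ := exists_normal_form g
    exact ⟨(⟨i, hi⟩, ⟨j, hj⟩), rfl⟩

theorem card : Nat.card QuasidihedralThirtyTwo = 32 := by
  rw [← Nat.card_congr (Equiv.ofBijective _ normal_form_bijective)]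
  simp

instance : Finite QuasidihedralThirtyTwo := Nat.finite_of_card_ne_zero (by rw [card]; norm_num)

section GroupAlgebra

variable {F : Type*} [Field F]

/-- Every element of the group algebra has the form `P(a) + Q(a) x`. -/
theorem exists_eq_aeval_add (r : MonoidAlgebra F QuasidihedralThirtyTwo) :
    ∃ P Q : F[X], r = aeval (MonoidAlgebra.of F _ a) P
      + aeval (MonoidAlgebra.of F _ a) Q * MonoidAlgebra.of F _ x := by
  induction r using MonoidAlgebra.induction_on with
  | of g =>
    obtain ⟨i, j, -, hj, rfl⟩ := exists_normal_form g
    interval_cases j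
    · exact ⟨X ^ i, 0, by simp [MonoidAlgebra.single_pow]⟩
    · exact ⟨0, X ^ i, by simp [MonoidAlgebra.single_pow, MonoidAlgebra.single_mul_single]⟩
  | add r s hr hs =>
    obtain ⟨P, Q, rfl⟩ := hr
    obtain ⟨P', Q', rfl⟩ := hs
    exact ⟨P + P', Q + Q', by simp only [map_add, add_mul]; abel⟩
  | smul c r hr =>
    obtain ⟨P, Q, rfl⟩ := hr
    exact ⟨c • P, c • Q, by simp only [map_smul, smul_add, smul_mul_assoc]⟩

theorem of_x_mul_aeval (P : F[X]) :
    MonoidAlgebra.of F _ x * aeval (MonoidAlgebra.of F _ a) P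
      = aeval (MonoidAlgebra.of F _ a ^ 7) P * MonoidAlgebra.of F _ x := by
  induction P using Polynomial.induction_on' with
  | add P Q hP hQ => simp only [map_add, mul_add, add_mul, hP, hQ]
  | monomial i c =>
    rw [aeval_monomial, aeval_monomial, ← mul_assoc, ← Algebra.commutes, mul_assoc, mul_assoc,
      ← pow_mul, ← map_pow, ← map_pow, ← map_mul, ← map_mul, x_mul_a_pow]

/-- The augmentation of the group algebra. -/
noncomputable def augmentation (F : Type*) [Field F] :
    MonoidAlgebra F QuasidihedralThirtyTwo →ₐ[F] F :=
  MonoidAlgebra.lift F F QuasidihedralThirtyTwo 1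

@[simp]
theorem augmentation_of (g : QuasidihedralThirtyTwo) :
    augmentation F (MonoidAlgebra.of F _ g) = 1 := by
  simp [augmentation]

theorem augmentation_surjective : Function.Surjective (augmentation F) := fun c =>
  ⟨algebraMap F _ c, by rw [AlgHom.commutes]; rfl⟩

/-- In characteristic two, the `2 ^ k`-th power of a polynomial in `r` is a polynomial in
`r ^ 2 ^ k`. -/
theorem aeval_pow_two_pow [CharP F 2] {R : Type*} [Ring R] [Algebra F R] (r : R) (P : F[X])
    (k : ℕ) : aeval r P ^ 2 ^ k = aeval (r ^ 2 ^ k) (P.map (iterateFrobenius F 2 k)) := by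
  rw [← map_pow, ← map_iterateFrobenius_expand 2 P k, map_expand, expand_aeval]

end GroupAlgebra

section CharTwo

variable {F : Type*} [Field F] [CharP F 2]

theorem pow_sixteen_eq_zero {r : MonoidAlgebra F QuasidihedralThirtyTwo}
    (hr : augmentation F r = 0) : r ^ 16 = 0 := by
  have hchar : CharP (MonoidAlgebra F QuasidihedralThirtyTwo) 2 :=
    charP_of_injective_algebraMap' F 2
  obtain ⟨P, Q, rfl⟩ := exists_eq_aeval_add r
  set A := MonoidAlgebra.of F QuasidihedralThirtyTwo a with hA
  set S := MonoidAlgebra.of F QuasidihedralThirtyTwo x with hS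
  have hA16 : A ^ 16 = 1 := by rw [hA, ← map_pow, a_pow, map_one]
  have hSS : S * S = 1 := by rw [hS, ← map_mul, x_mul_x, map_one]
  have hA7 : (A ^ 7) ^ 7 = A := by
    rw [← pow_mul, show 7 * 7 = 16 * 3 + 1 from rfl, pow_succ, pow_mul, hA16, one_pow, one_mul]
  have h78 : (A ^ 7) ^ 8 = A ^ 8 := by
    rw [← pow_mul, show 7 * 8 = 16 * 3 + 8 from rfl, pow_add, pow_mul, hA16, one_pow, one_mul]
  have hcomm (B C : F[X]) (i j : ℕ) : Commute (aeval (A ^ i) B) (aeval (A ^ j) C) := by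
    have h (i : ℕ) (B : F[X]) : aeval (A ^ i) B = aeval A (B.comp (X ^ i)) := by
      rw [aeval_comp, map_pow, aeval_X]
    rw [h i, h j]
    exact Commute.all (B.comp (X ^ i)) (C.comp (X ^ j)) |>.map (aeval A)
  have hS1 (B : F[X]) : S * aeval A B = aeval (A ^ 7) B * S := of_x_mul_aeval B
  have hS7 (B : F[X]) : S * aeval (A ^ 7) B = aeval A B * S := by
    calc S * aeval (A ^ 7) B = S * (aeval (A ^ 7) B * S) * S := by
          rw [mul_assoc, mul_assoc, hSS, mul_one]
      _ = aeval A B * S := by rw [← hS1, ← mul_assoc S S, hSS, one_mul]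
  have hε : (P + Q).eval 1 = 0 := by
    rw [map_add, map_mul, ← aeval_algHom_apply, ← aeval_algHom_apply, augmentation_of,
      augmentation_of, mul_one, ← map_add] at hr
    simpa [aeval_def] using hr
  have h8 (B : F[X]) : aeval (A ^ 7) B ^ 8 = aeval A B ^ 8 := by
    rw [show 8 = 2 ^ 3 from rfl, aeval_pow_two_pow, aeval_pow_two_pow, ← show 8 = 2 ^ 3 from rfl,
      h78]
  have h16 : aeval A P ^ 16 + aeval A Q ^ 16 = 0 := by
    have := add_pow_char_pow_of_commute 2 4
      (show Commute (aeval A P) (aeval A Q) by simpa using hcomm P Q 1 1)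
    rw [← map_add, aeval_pow_two_pow, ← show 16 = 2 ^ 4 from rfl, hA16] at this
    rw [← this, ← map_one (algebraMap F (MonoidAlgebra F QuasidihedralThirtyTwo)),
      aeval_algebraMap_apply, coe_aeval_eq_eval, eval_one_map, hε, map_zero, map_zero]
  have hcαα' : Commute (aeval A P) (aeval (A ^ 7) P) := by simpa using hcomm P P 1 7
  have hcββ' : Commute (aeval A Q) (aeval (A ^ 7) Q) := by simpa using hcomm Q Q 1 7
  have hcαβ : Commute (aeval A P) (aeval A Q) := by simpa using hcomm P Q 1 1
  have hcα'β : Commute (aeval (A ^ 7) P) (aeval A Q) := by simpa using hcomm P Q 7 1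
  have hcα'β' : Commute (aeval (A ^ 7) P) (aeval (A ^ 7) Q) := by simpa using hcomm P Q 7 7
  have hcαβ' : Commute (aeval A P) (aeval (A ^ 7) Q) := by simpa using hcomm P Q 1 7
  have hSα := hS1 P
  have hSβ := hS1 Q
  have hSα' := hS7 P
  have hSβ' := hS7 Q
  have hα8 := h8 P
  have hβ8 := h8 Q
  generalize aeval A P = α at *
  generalize aeval A Q = β at *
  generalize aeval (A ^ 7) P = α' at *
  generalize aeval (A ^ 7) Q = β' at *
  have hsq : (α + β * S) ^ 2 = (α + α') * (α + β * S) + (α * α' + β * β') := by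
    have h1 : β * S * (β * S) = β * β' := by
      rw [mul_assoc, ← mul_assoc S, hSβ, mul_assoc, hSS, mul_one]
    have h2 : β * S * α = α' * (β * S) := by
      rw [mul_assoc, hSα, ← mul_assoc, ← mul_assoc, hcα'β.eq]
    have h3 : α * α' + α * α' = 0 := CharTwo.add_self_eq_zero _
    calc (α + β * S) ^ 2 = α * α + α * (β * S) + β * S * α + β * S * (β * S) := by
          rw [sq]; simp only [mul_add, add_mul]; abel
      _ = α * α + α * (β * S) + α' * (β * S) + β * β' + (α * α' + α * α') := by
          rw [h1, h2, h3, add_zero]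
      _ = _ := by simp only [mul_add, add_mul, hcαα'.eq]; abel
  have htS : Commute (α + α') S := by
    rw [Commute, SemiconjBy, mul_add, add_mul, hSα, hSα', add_comm]
  have hdS : Commute (α * α' + β * β') S := by
    rw [Commute, SemiconjBy, mul_add, add_mul, ← mul_assoc, ← mul_assoc, hSα, hSβ, mul_assoc α',
      mul_assoc β', hSα', hSβ', ← mul_assoc, ← mul_assoc, hcαα'.eq, hcββ'.eq]
  have htα : Commute (α + α') α := (Commute.refl α).add_left hcαα'.symm
  have htβ : Commute (α + α') β := hcαβ.add_left hcα'β
  have hdα : Commute (α * α' + β * β') α :=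
    ((Commute.refl α).mul_left hcαα'.symm).add_left (hcαβ.symm.mul_left hcαβ'.symm)
  have hdβ : Commute (α * α' + β * β') β :=
    (hcαβ.mul_left hcα'β).add_left ((Commute.refl β).mul_left hcββ'.symm)
  have hdα' : Commute (α * α' + β * β') α' :=
    (hcαα'.mul_left (Commute.refl α')).add_left (hcα'β.symm.mul_left hcα'β'.symm)
  have htj : Commute (α + α') (α + β * S) := htα.add_right (htβ.mul_right htS)
  have hdj : Commute (α * α' + β * β') (α + β * S) := hdα.add_right (hdβ.mul_right hdS)
  have hdt : Commute (α * α' + β * β') (α + α') := hdα.add_right hdα'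
  rw [show 16 = 2 * 2 ^ 3 from rfl, pow_mul, hsq,
    add_pow_char_pow_of_commute 2 3 (hdt.mul_right hdj).symm, htj.mul_pow,
    add_pow_char_pow_of_commute 2 3 hcαα',
    add_pow_char_pow_of_commute 2 3 ((hcαβ.mul_left hcα'β).mul_right (hcαβ'.mul_left hcα'β')),
    hcαα'.mul_pow, hcββ'.mul_pow, ← show 8 = 2 ^ 3 from rfl, hα8, hβ8, ← pow_add, ← pow_add, h16,
    CharTwo.add_self_eq_zero, zero_mul, add_zero]

end CharTwo

/-- The augmentation on units. -/
noncomputable def augmentationUnits (F : Type*) [Field F] :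
    (MonoidAlgebra F QuasidihedralThirtyTwo)ˣ →* Fˣ :=
  Units.map (augmentation F : MonoidAlgebra F QuasidihedralThirtyTwo →* F)

theorem augmentationUnits_surjective {F : Type*} [Field F] : Function.Surjective (augmentationUnits F) :=
  fun c => ⟨Units.map (algebraMap F (MonoidAlgebra F QuasidihedralThirtyTwo)).toMonoidHom c, by
    ext
    exact (augmentation F).commutes c⟩

section CharTwo

variable {F : Type*} [Field F] [CharP F 2]

theorem mem_jacobson_iff (r : MonoidAlgebra F QuasidihedralThirtyTwo) :
    r ∈ Ring.jacobson (MonoidAlgebra F QuasidihedralThirtyTwo) ↔ augmentation F r = 0 := by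
  constructor
  · intro hr
    have : RingHomSurjective (augmentation F).toRingHom := ⟨augmentation_surjective⟩
    have h := Ring.le_comap_jacobson (augmentation F).toRingHom hr
    rwa [IsArtinianRing.isSemisimpleRing_iff_jacobson.1 inferInstance] at h
  · intro hr
    rw [← Ideal.jacobson_bot, Ideal.mem_jacobson_iff]
    intro y
    have hnil : IsNilpotent (y * r) :=
      ⟨16, pow_sixteen_eq_zero (by rw [map_mul, hr, mul_zero])⟩
    obtain ⟨u, hu⟩ := hnil.isUnit_one_add
    refine ⟨(u⁻¹ : (MonoidAlgebra F QuasidihedralThirtyTwo)ˣ), ?_⟩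
    rw [Ideal.mem_bot, sub_eq_zero, mul_assoc, ← mul_add_one, add_comm, ← hu, Units.inv_mul]

theorem mem_oneAddJacobson_iff (u : (MonoidAlgebra F QuasidihedralThirtyTwo)ˣ) :
    u ∈ oneAddJacobson (MonoidAlgebra F QuasidihedralThirtyTwo) ↔ augmentation F u = 1 := by
  constructor
  · rintro ⟨j, hj, hu⟩
    rw [hu, map_add, map_one, (mem_jacobson_iff j).1 hj, add_zero]
  · intro hu
    exact ⟨u - 1, (mem_jacobson_iff _).2 (by rw [map_sub, hu, map_one, sub_self]), by simp⟩

theorem oneAddJacobson_eq_ker :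
    oneAddJacobson (MonoidAlgebra F QuasidihedralThirtyTwo) = (augmentationUnits F).ker := by
  ext u
  rw [mem_oneAddJacobson_iff, MonoidHom.mem_ker, Units.ext_iff]
  rfl

/-- The bijection `u ↦ u - 1` from `V₁` to the augmentation ideal. -/
noncomputable def oneAddJacobsonEquiv :
    oneAddJacobson (MonoidAlgebra F QuasidihedralThirtyTwo) ≃ (augmentation F).toLinearMap.ker where
  toFun u := ⟨(u : (MonoidAlgebra F QuasidihedralThirtyTwo)ˣ) - 1, by
    have := (mem_oneAddJacobson_iff _).1 u.2
    rw [LinearMap.mem_ker, AlgHom.toLinearMap_apply, map_sub, this, map_one, sub_self]⟩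
  invFun j := ⟨(show IsNilpotent (j : MonoidAlgebra F QuasidihedralThirtyTwo) from
      ⟨16, pow_sixteen_eq_zero j.2⟩).isUnit_one_add.unit, by
    have : augmentation F j = 0 := j.2
    rw [mem_oneAddJacobson_iff, IsUnit.unit_spec, map_add, map_one, this, add_zero]⟩
  left_inv u := by ext1; ext1; simp
  right_inv j := by ext1; simp

theorem finrank_monoidAlgebra (F : Type*) [Field F] :
    Module.finrank F (MonoidAlgebra F QuasidihedralThirtyTwo) = 32 := by
  rw [← card, Module.finrank_eq_nat_card_basis (MonoidAlgebra.basis _ _)]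

theorem card_oneAddJacobson [Finite F] :
    Nat.card (oneAddJacobson (MonoidAlgebra F QuasidihedralThirtyTwo)) = Nat.card F ^ 31 := by
  have h := LinearMap.finrank_range_add_finrank_ker (augmentation F).toLinearMap
  rw [LinearMap.range_eq_top.2 augmentation_surjective, finrank_top, Module.finrank_self,
    finrank_monoidAlgebra] at h
  rw [Nat.card_congr oneAddJacobsonEquiv, Module.natCard_eq_pow_finrank (K := F)]
  congr 1
  omega

theorem exponent_oneAddJacobson :
    Monoid.exponent (oneAddJacobson (MonoidAlgebra F QuasidihedralThirtyTwo)) = 16 := by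
  have hchar : CharP (MonoidAlgebra F QuasidihedralThirtyTwo) 2 :=
    charP_of_injective_algebraMap' F 2
  apply Nat.dvd_antisymm
  · apply Monoid.exponent_dvd_of_forall_pow_eq_one
    rintro ⟨u, hu⟩
    ext1
    ext1
    have h0 : augmentation F ((u : MonoidAlgebra F QuasidihedralThirtyTwo) - 1) = 0 := by
      rw [map_sub, (mem_oneAddJacobson_iff u).1 hu, map_one, sub_self]
    have h := add_pow_char_pow_of_commute 2 4
      (Commute.one_right ((u : MonoidAlgebra F QuasidihedralThirtyTwo) - 1))
    rw [sub_add_cancel, ← show 16 = 2 ^ 4 from rfl, pow_sixteen_eq_zero h0, zero_add,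
      one_pow] at h
    simpa using h
  · have hinj : Function.Injective (MonoidAlgebra.of F QuasidihedralThirtyTwo) :=
      MonoidAlgebra.of_injective
    let v : oneAddJacobson (MonoidAlgebra F QuasidihedralThirtyTwo) :=
      ⟨Units.map (MonoidAlgebra.of F QuasidihedralThirtyTwo) (toUnits a), by
        rw [mem_oneAddJacobson_iff]
        exact augmentation_of a⟩
    have hv : orderOf v = orderOf a := by
      rw [← Subgroup.orderOf_coe, ← orderOf_units]
      exact orderOf_injective (MonoidAlgebra.of F QuasidihedralThirtyTwo) hinj a
    have ha : orderOf a = 16 := by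
      refine orderOf_eq_prime_pow (p := 2) (n := 3) (fun h => ?_) a_pow
      have h2 := congrArg (fun g => affineHom g 0) h
      have h3 := affineHom_apply 8 0 0
      rw [pow_zero, mul_one] at h3
      simp only [show 2 ^ 3 = 8 from rfl, h3, map_one] at h2
      revert h2
      decide
    rw [← ha, ← hv]
    exact Monoid.order_dvd_exponent v

end CharTwo

end QuasidihedralThirtyTwo

/-- The Chinese remainder theorem for values of polynomials at pairwise non-conjugate
algebraic elements. -/
theorem exists_forall_aeval_eq {F Ω ι : Type*} [Field F] [Field Ω] [Algebra F Ω] [Finite ι]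
    (τ : ι → Ω) (hτ : ∀ i, IsIntegral F (τ i)) (hinj : Function.Injective fun i => minpoly F (τ i))
    (Q : ι → F[X]) : ∃ P : F[X], ∀ i, aeval (τ i) P = aeval (τ i) (Q i) := by
  have hcop : Pairwise fun i j =>
      IsCoprime (Ideal.span {minpoly F (τ i)}) (Ideal.span {minpoly F (τ j)}) := by
    intro i j hij
    rw [Ideal.isCoprime_span_singleton_iff]
    refine ((minpoly.irreducible (hτ i)).coprime_iff_not_dvd).2 fun h => hij (hinj ?_)
    exact eq_of_monic_of_associated (minpoly.monic (hτ i)) (minpoly.monic (hτ j))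
      ((minpoly.irreducible (hτ i)).associated_of_dvd (minpoly.irreducible (hτ j)) h)
  obtain ⟨P, hP⟩ := Ideal.exists_forall_sub_mem_ideal hcop Q
  refine ⟨P, fun i => ?_⟩
  obtain ⟨R, hR⟩ := Ideal.mem_span_singleton.1 (hP i)
  rw [← sub_eq_zero, ← map_sub, hR, map_mul, minpoly.aeval, zero_mul]

theorem exists_aeval_gen_eq {F Ω : Type*} [Field F] [Field Ω] [Algebra F Ω] {t : Ω}
    (ht : IsIntegral F t) (w : F⟮t⟯) : ∃ P : F[X], aeval t P = w := by
  have hw : (w : Ω) ∈ F⟮t⟯.toSubalgebra := w.2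
  rw [adjoin_simple_toSubalgebra_of_isAlgebraic ht.isAlgebraic,
    Algebra.adjoin_singleton_eq_range_aeval] at hw
  exact hw

theorem Matrix.fin_two_ext {K : Type*} {a b c d a' b' c' d' : K} (ha : a = a') (hb : b = b')
    (hc : c = c') (hd : d = d') : !![a, b; c, d] = !![a', b'; c', d'] := by
  rw [ha, hb, hc, hd]

namespace QuasidihedralThirtyTwo

section Matrices

variable {K : Type*} [Field K]

/-- The companion matrix of `X ^ 2 - t X + d`, by which the rotation acts. -/
def rot (t d : K) : Matrix (Fin 2) (Fin 2) K := !![0, -d; 1, t]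

/-- The matrix by which the reflection acts. -/
def refl (t : K) : Matrix (Fin 2) (Fin 2) K := !![1, t; 0, -1]

theorem refl_sq (t : K) : refl t ^ 2 = 1 := by
  rw [sq, refl, Matrix.mul_fin_two, Matrix.one_fin_two]
  simp

theorem refl_mul_rot_mul_refl (t d : K) : refl t * rot t d * refl t = !![t, d; -1, 0] := by
  rw [refl, rot, Matrix.mul_fin_two, Matrix.mul_fin_two]
  congr! 3 <;> ring_nf

theorem rot_pow_eight_of_det_one {t : K} (ht : t * (t ^ 2 - 2) = 0) :
    rot t 1 ^ 8 = (1 : K) • 1 := by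
  have h4 : rot t 1 ^ 4 = !![1 - t ^ 2, 0; 0, 1 - t ^ 2] := by
    rw [show 4 = 2 * 2 from rfl, pow_mul, sq, sq, rot, Matrix.mul_fin_two, Matrix.mul_fin_two]
    apply Matrix.fin_two_ext
    · ring
    · linear_combination -ht
    · linear_combination ht
    · linear_combination t * ht
  rw [show 8 = 4 * 2 from rfl, pow_mul, h4, sq, Matrix.mul_fin_two, Matrix.one_fin_two, one_smul]
  apply Matrix.fin_two_ext
  · linear_combination t * ht
  · ring
  · ring
  · linear_combination t * ht

theorem rot_pow_eight_of_det_neg_one {t : K} (ht : t ^ 4 + 4 * t ^ 2 + 2 = 0) :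
    rot t (-1) ^ 8 = (-1 : K) • 1 := by
  have h4 : rot t (-1) ^ 4 = !![1 + t ^ 2, t ^ 3 + 2 * t; t ^ 3 + 2 * t, -1 - t ^ 2] := by
    rw [show 4 = 2 * 2 from rfl, pow_mul, sq, sq, rot, Matrix.mul_fin_two, Matrix.mul_fin_two]
    apply Matrix.fin_two_ext
    · ring
    · ring
    · ring
    · linear_combination ht
  rw [show 8 = 4 * 2 from rfl, pow_mul, h4, sq, Matrix.mul_fin_two, Matrix.one_fin_two]
  simp only [Matrix.smul_of, Matrix.smul_cons, Matrix.smul_empty, smul_eq_mul]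
  apply Matrix.fin_two_ext
  · linear_combination (t ^ 2 + 1) * ht
  · ring
  · ring
  · linear_combination (t ^ 2 + 1) * ht

theorem rot_pow_seven {t d : K} (hd : d * d = 1) (h : rot t d ^ 8 = d • 1) :
    rot t d ^ 7 = !![t, d; -1, 0] := by
  have hinv : rot t d * !![t, d; -1, 0] = d • 1 := by
    rw [rot, Matrix.mul_fin_two]
    ext i j
    fin_cases i <;> fin_cases j <;> simp
  calc rot t d ^ 7 = d • (rot t d ^ 7 * (d • 1)) := by
        rw [mul_smul_comm, mul_one, smul_smul, hd, one_smul]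
    _ = d • (rot t d ^ 8 * !![t, d; -1, 0]) := by rw [← hinv, pow_succ _ 7, mul_assoc]
    _ = !![t, d; -1, 0] := by rw [h, smul_mul_assoc, one_mul, smul_smul, hd, one_smul]

theorem rot_pow_sixteen {t d : K} (hd : d * d = 1) (h : rot t d ^ 8 = d • 1) :
    rot t d ^ 16 = 1 := by
  rw [show 16 = 8 * 2 from rfl, pow_mul, h, sq, smul_mul_smul_comm, hd, one_smul, one_mul]

theorem rot_add_rot_pow_seven {t d : K} (hd : d * d = 1) (h : rot t d ^ 8 = d • 1) :
    rot t d + rot t d ^ 7 = algebraMap K _ t := by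
  rw [rot_pow_seven hd h, rot, Matrix.algebraMap_eq_diagonal]
  ext i j
  fin_cases i <;> fin_cases j <;> simp

/-- Away from the branch points, the products of `rot` and `refl` span the matrix algebra. -/
theorem exists_eq_combination {t d : K} (h2 : (2 : K) ≠ 0)
    (hdisc : t ^ 2 - 4 * d ≠ 0) (M : Matrix (Fin 2) (Fin 2) K) :
    ∃ w₁ w₂ w₃ w₄ : K, algebraMap K _ w₁ + algebraMap K _ w₂ * rot t d
      + algebraMap K _ w₃ * refl t + algebraMap K _ w₄ * (rot t d * refl t) = M := by
  set D := t ^ 2 - 4 * d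
  let w₂ := (2 * (M 0 1 - d * M 1 0) + t * (M 1 1 - M 0 0)) / D
  let w₃ := (t * w₂ - (M 1 1 - M 0 0)) / 2
  refine ⟨M 0 0 - w₃, w₂, w₃, M 1 0 - w₂, ?_⟩
  have e2 : w₂ * D = 2 * (M 0 1 - d * M 1 0) + t * (M 1 1 - M 0 0) := div_mul_cancel₀ _ hdisc
  have e3 : w₃ * 2 = t * w₂ - (M 1 1 - M 0 0) := div_mul_cancel₀ _ h2
  generalize w₂ = w₂ at *
  generalize w₃ = w₃ at *
  simp only [← Algebra.smul_def]
  rw [Matrix.algebraMap_eq_diagonal, rot, refl, Matrix.mul_fin_two]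
  ext i j
  fin_cases i <;> fin_cases j <;> simp
  · apply mul_left_cancel₀ h2
    linear_combination e2 + t * e3
  · linear_combination -e3

end Matrices

section SplitAlgebra

variable (F : Type*) {Ω ι κ : Type*} [Field F] [Field Ω] [Algebra F Ω] (τ : ι → Ω) (σ : κ → Ω)

/-- The product of four copies of `F` and of the algebras of two by two matrices over the fields
`F⟮τ i⟯` and `F⟮σ k⟯`. -/
abbrev SplitAlgebra : Type _ :=
  (Fin 4 → F) × (∀ i, Matrix (Fin 2) (Fin 2) F⟮τ i⟯) × (∀ k, Matrix (Fin 2) (Fin 2) F⟮σ k⟯)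

/-- The image of the rotation in `SplitAlgebra`. -/
def splitRot : SplitAlgebra F τ σ :=
  (![1, 1, -1, -1], fun i => rot (AdjoinSimple.gen F (τ i)) 1,
    fun k => rot (AdjoinSimple.gen F (σ k)) (-1))

/-- The image of the reflection in `SplitAlgebra`. -/
def splitRefl : SplitAlgebra F τ σ :=
  (![1, -1, 1, -1], fun i => refl (AdjoinSimple.gen F (τ i)),
    fun k => refl (AdjoinSimple.gen F (σ k)))

variable {F τ σ}

theorem gen_relation_of_det_one {t : Ω} (ht : t * (t ^ 2 - 2) = 0) :
    AdjoinSimple.gen F t * (AdjoinSimple.gen F t ^ 2 - 2) = 0 :=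
  (algebraMap F⟮t⟯ Ω).injective <| by
    rw [map_mul, map_sub, map_pow, AdjoinSimple.algebraMap_gen, map_ofNat, ht, map_zero]

theorem gen_relation_of_det_neg_one {t : Ω} (ht : t ^ 4 + 4 * t ^ 2 + 2 = 0) :
    AdjoinSimple.gen F t ^ 4 + 4 * AdjoinSimple.gen F t ^ 2 + 2 = 0 :=
  (algebraMap F⟮t⟯ Ω).injective <| by
    rw [map_add, map_add, map_mul, map_pow, map_pow, AdjoinSimple.algebraMap_gen, map_ofNat,
      map_ofNat, ht, map_zero]

theorem rot_gen_pow_eight_of_det_one {t : Ω} (ht : t * (t ^ 2 - 2) = 0) :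
    rot (AdjoinSimple.gen F t) 1 ^ 8 = (1 : F⟮t⟯) • 1 :=
  rot_pow_eight_of_det_one (gen_relation_of_det_one ht)

theorem rot_gen_pow_eight_of_det_neg_one {t : Ω} (ht : t ^ 4 + 4 * t ^ 2 + 2 = 0) :
    rot (AdjoinSimple.gen F t) (-1) ^ 8 = (-1 : F⟮t⟯) • 1 :=
  rot_pow_eight_of_det_neg_one (gen_relation_of_det_neg_one ht)

variable (hτ : ∀ i, τ i * (τ i ^ 2 - 2) = 0) (hσ : ∀ k, σ k ^ 4 + 4 * σ k ^ 2 + 2 = 0)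

include hτ hσ in
theorem splitRot_pow_eight : splitRot F τ σ ^ 8 = (1, 1, -1) := by
  refine Prod.ext ?_ (Prod.ext ?_ ?_)
  · funext i
    fin_cases i <;> simp [splitRot] <;> norm_num
  · funext i
    exact (rot_gen_pow_eight_of_det_one (hτ i)).trans (one_smul _ _)
  · funext k
    exact (rot_gen_pow_eight_of_det_neg_one (hσ k)).trans (neg_one_smul _ _)

include hτ hσ in
theorem splitRot_pow_sixteen : splitRot F τ σ ^ 16 = 1 := by
  refine Prod.ext ?_ (Prod.ext ?_ ?_)
  · funext i
    fin_cases i <;> simp [splitRot] <;> norm_num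
  · funext i
    exact rot_pow_sixteen (one_mul 1) (rot_gen_pow_eight_of_det_one (hτ i))
  · funext k
    exact rot_pow_sixteen (neg_one_mul (-1) |>.trans (neg_neg 1))
      (rot_gen_pow_eight_of_det_neg_one (hσ k))

theorem splitRefl_sq : splitRefl F τ σ ^ 2 = 1 := by
  refine Prod.ext ?_ (Prod.ext ?_ ?_)
  · funext i
    fin_cases i <;> simp [splitRefl]
  · funext i
    exact refl_sq _
  · funext k
    exact refl_sq _

include hτ hσ in
theorem splitRefl_mul_splitRot_mul_splitRefl :
    splitRefl F τ σ * splitRot F τ σ * splitRefl F τ σ = splitRot F τ σ ^ 7 := by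
  refine Prod.ext ?_ (Prod.ext ?_ ?_)
  · funext i
    fin_cases i <;> simp [splitRot, splitRefl] <;> norm_num
  · funext i
    exact (refl_mul_rot_mul_refl _ _).trans
      (rot_pow_seven (one_mul 1) (rot_gen_pow_eight_of_det_one (hτ i))).symm
  · funext k
    exact (refl_mul_rot_mul_refl _ _).trans (rot_pow_seven
      (neg_one_mul (-1) |>.trans (neg_neg 1)) (rot_gen_pow_eight_of_det_neg_one (hσ k))).symm

variable (F τ σ) in
/-- The homomorphism from the group algebra to `SplitAlgebra`. -/
noncomputable def splitHom :
    MonoidAlgebra F QuasidihedralThirtyTwo →ₐ[F] SplitAlgebra F τ σ :=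
  MonoidAlgebra.lift F (SplitAlgebra F τ σ) QuasidihedralThirtyTwo <|
    lift (splitRot F τ σ) (splitRefl F τ σ) (splitRot_pow_sixteen hτ hσ) splitRefl_sq
      (splitRefl_mul_splitRot_mul_splitRefl hτ hσ)

theorem splitRot_mem_range : splitRot F τ σ ∈ (splitHom F τ σ hτ hσ).range :=
  ⟨MonoidAlgebra.of F _ a, by simp [splitHom]⟩

theorem splitRefl_mem_range : splitRefl F τ σ ∈ (splitHom F τ σ hτ hσ).range :=
  ⟨MonoidAlgebra.of F _ x, by simp [splitHom]⟩

include hτ hσ in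
/-- The values of polynomials at the central element `a + a ^ 7`. -/
theorem aeval_splitRot_add_splitRot_pow_seven (P : F[X]) :
    aeval (splitRot F τ σ + splitRot F τ σ ^ 7) P =
      (![P.eval 2, P.eval 2, P.eval (-2), P.eval (-2)],
        fun i => algebraMap F⟮τ i⟯ _ (aeval (AdjoinSimple.gen F (τ i)) P),
        fun k => algebraMap F⟮σ k⟯ _ (aeval (AdjoinSimple.gen F (σ k)) P)) := by
  set c := splitRot F τ σ + splitRot F τ σ ^ 7 with hc
  refine Prod.ext ?_ (Prod.ext ?_ ?_)
  · funext i
    refine (aeval_algHom_apply ((Pi.evalAlgHom F _ i).comp (AlgHom.fst F _ _)) c P).symm.trans ?_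
    rw [coe_aeval_eq_eval]
    change P.eval ((![1, 1, -1, -1] : Fin 4 → F) i + (![1, 1, -1, -1] : Fin 4 → F) i ^ 7) = _
    fin_cases i <;> simp <;> norm_num
  · funext i
    refine (aeval_algHom_apply ((Pi.evalAlgHom F _ i).comp
      ((AlgHom.fst F _ _).comp (AlgHom.snd F _ _))) c P).symm.trans ?_
    change aeval (rot (AdjoinSimple.gen F (τ i)) 1 + rot (AdjoinSimple.gen F (τ i)) 1 ^ 7) P = _
    rw [rot_add_rot_pow_seven (one_mul 1) (rot_gen_pow_eight_of_det_one (hτ i)),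
      aeval_algebraMap_apply]
  · funext k
    refine (aeval_algHom_apply ((Pi.evalAlgHom F _ k).comp
      ((AlgHom.snd F _ _).comp (AlgHom.snd F _ _))) c P).symm.trans ?_
    change aeval (rot (AdjoinSimple.gen F (σ k)) (-1) + rot (AdjoinSimple.gen F (σ k)) (-1) ^ 7) P
      = _
    rw [rot_add_rot_pow_seven (neg_one_mul (-1) |>.trans (neg_neg 1))
      (rot_gen_pow_eight_of_det_neg_one (hσ k)), aeval_algebraMap_apply]

theorem eq_algebraMap_of_minpoly_eq {t : Ω} {c : F}
    (h : minpoly F t = minpoly F (algebraMap F Ω c)) : t = algebraMap F Ω c := by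
  have := minpoly.aeval F t
  rwa [h, minpoly.eq_X_sub_C, map_sub, aeval_X, aeval_C, sub_eq_zero] at this

/-- A root of `X (X ^ 2 - 2)` is different from `2` and `-2`. -/
theorem sq_ne_four {K : Type*} [Field K] (h2 : (2 : K) ≠ 0) {t : K} (ht : t * (t ^ 2 - 2) = 0) :
    t ^ 2 - 4 * 1 ≠ 0 := by
  intro h
  have h0 : t = 0 := mul_left_cancel₀ h2 (by linear_combination ht - t * h)
  rw [h0] at h
  exact mul_ne_zero h2 h2 (by linear_combination -h)

theorem aeval_gen_eq {t : Ω} {P : F[X]} {w : F⟮t⟯} (h : aeval t P = w) :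
    aeval (AdjoinSimple.gen F t) P = w := by
  apply (algebraMap F⟮t⟯ Ω).injective
  rw [← aeval_algebraMap_apply, AdjoinSimple.algebraMap_gen, h]
  rfl

theorem inv_two_smul_one_add_one {R : Type*} [Ring R] [Algebra F R] (h2 : (2 : F) ≠ 0) :
    (2 : F)⁻¹ • ((1 : R) + 1) = 1 := by
  rw [← two_smul F (1 : R), smul_smul, inv_mul_cancel₀ h2, one_smul]

/-- The image of the group algebra contains enough central elements. -/
theorem central_mem_range [Finite ι] [Finite κ] [Algebra.IsAlgebraic F Ω] (h2 : (2 : F) ≠ 0)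
    (hτ' : Function.Injective fun i => minpoly F (τ i))
    (hσ' : Function.Injective fun k => minpoly F (σ k))
    (u v : F) (w : ∀ i, F⟮τ i⟯) (w' : ∀ k, F⟮σ k⟯) :
    ((![u, u, v, v], fun i => algebraMap _ _ (w i), fun k => algebraMap _ _ (w' k)) :
      SplitAlgebra F τ σ) ∈ (splitHom F τ σ hτ hσ).range := by
  have hint (t : Ω) : IsIntegral F t := Algebra.IsIntegral.isIntegral t
  choose Pτ hPτ using fun i => exists_aeval_gen_eq (hint (τ i)) (w i)
  choose Pσ hPσ using fun k => exists_aeval_gen_eq (hint (σ k)) (w' k)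
  obtain ⟨Q, hQ⟩ := exists_forall_aeval_eq σ (fun k => hint _) hσ' Pσ
  have h4 (i) (c : F) (hc : c ^ 2 = 4) : τ i ≠ algebraMap F Ω c := fun h => by
    refine sq_ne_four (K := Ω) ?_ (hτ i) ?_
    · rw [← map_ofNat (algebraMap F Ω) 2]
      exact (_root_.map_ne_zero _).2 h2
    · rw [h, ← map_pow, hc, map_ofNat, mul_one, sub_self]
  have h22 : algebraMap F Ω 2 ≠ algebraMap F Ω (-2) := fun h =>
    mul_ne_zero h2 h2 (by linear_combination (algebraMap F Ω).injective h)
  have hinj : Function.Injective fun o : Option (Option ι) => minpoly F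
      (o.elim (algebraMap F Ω 2) fun o => o.elim (algebraMap F Ω (-2)) τ) := by
    rintro (_ | _ | i) (_ | _ | j) h
    · rfl
    · exact absurd (eq_algebraMap_of_minpoly_eq h) h22
    · exact absurd (eq_algebraMap_of_minpoly_eq h.symm) (h4 j 2 (by norm_num))
    · exact absurd (eq_algebraMap_of_minpoly_eq h.symm) h22
    · rfl
    · exact absurd (eq_algebraMap_of_minpoly_eq h.symm) (h4 j (-2) (by norm_num))
    · exact absurd (eq_algebraMap_of_minpoly_eq h) (h4 i 2 (by norm_num))
    · exact absurd (eq_algebraMap_of_minpoly_eq h) (h4 i (-2) (by norm_num))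
    · exact congrArg (some ∘ some) (hτ' h)
  obtain ⟨P, hP⟩ := exists_forall_aeval_eq
    (fun o : Option (Option ι) => o.elim (algebraMap F Ω 2) fun o =>
      o.elim (algebraMap F Ω (-2)) τ) (fun _ => hint _)
    hinj
    (fun o => o.elim (C u) fun o => o.elim (C v) Pτ)
  have hP2 : P.eval 2 = u := by
    have := hP none
    rw [Option.elim_none, Option.elim_none, aeval_algebraMap_apply, aeval_C] at this
    exact (algebraMap F Ω).injective this
  have hP2' : P.eval (-2) = v := by
    have := hP (some none)
    rw [Option.elim_some, Option.elim_none, Option.elim_some, Option.elim_none,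
      aeval_algebraMap_apply, aeval_C] at this
    exact (algebraMap F Ω).injective this
  have hPw (i) : aeval (AdjoinSimple.gen F (τ i)) P = w i :=
    aeval_gen_eq ((hP (some (some i))).trans (hPτ i))
  have hQw (k) : aeval (AdjoinSimple.gen F (σ k)) Q = w' k := aeval_gen_eq ((hQ k).trans (hPσ k))
  set A := splitRot F τ σ
  have hA := splitRot_mem_range (F := F) hτ hσ
  have hc : ∀ R : F[X], aeval (A + A ^ 7) R ∈ (splitHom F τ σ hτ hσ).range := fun R => by
    obtain ⟨r, hr⟩ := add_mem hA (pow_mem hA 7)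
    exact ⟨aeval r R, by rw [← hr]; exact (aeval_algHom_apply (splitHom F τ σ hτ hσ) r R).symm⟩
  convert add_mem (mul_mem (hc P) (Subalgebra.smul_mem _ (add_mem (one_mem _) (pow_mem hA 8))
    (2 : F)⁻¹)) (mul_mem (hc Q) (Subalgebra.smul_mem _ (sub_mem (one_mem _) (pow_mem hA 8))
    (2 : F)⁻¹)) using 1
  rw [aeval_splitRot_add_splitRot_pow_seven hτ hσ, aeval_splitRot_add_splitRot_pow_seven hτ hσ,
    splitRot_pow_eight hτ hσ]
  have hp : (2 : F)⁻¹ • ((1 : SplitAlgebra F τ σ) + (1, 1, -1)) = (1, 1, 0) :=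
    Prod.ext (inv_two_smul_one_add_one h2) (Prod.ext (inv_two_smul_one_add_one h2) (by
      change (2 : F)⁻¹ • (1 + -1) = 0
      rw [add_neg_cancel, smul_zero]))
  have hm : (2 : F)⁻¹ • ((1 : SplitAlgebra F τ σ) - (1, 1, -1)) = (0, 0, 1) :=
    Prod.ext (by change (2 : F)⁻¹ • (1 - 1) = 0; rw [sub_self, smul_zero])
      (Prod.ext (by change (2 : F)⁻¹ • (1 - 1) = 0; rw [sub_self, smul_zero]) (by
        change (2 : F)⁻¹ • (1 - -1) = 1
        rw [sub_neg_eq_add]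
        exact inv_two_smul_one_add_one h2))
  rw [hp, hm, hP2, hP2']
  simp [hPw, hQw]

theorem splitHom_surjective [Finite ι] [Finite κ] [Algebra.IsAlgebraic F Ω] (h2 : (2 : F) ≠ 0)
    (hτ' : Function.Injective fun i => minpoly F (τ i))
    (hσ' : Function.Injective fun k => minpoly F (σ k)) :
    Function.Surjective (splitHom F τ σ hτ hσ) := by
  have hK2 (K : IntermediateField F Ω) : (2 : K) ≠ 0 := by
    rw [← map_ofNat (algebraMap F K) 2]
    exact (_root_.map_ne_zero _).2 h2
  rintro ⟨y, M, N⟩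
  have hM (i) := exists_eq_combination (t := AdjoinSimple.gen F (τ i)) (d := 1) (hK2 _)
    (sq_ne_four (hK2 _) (gen_relation_of_det_one (hτ i))) (M i)
  have hN (k) := exists_eq_combination (t := AdjoinSimple.gen F (σ k)) (d := -1) (hK2 _)
    (fun h => hK2 F⟮σ k⟯ (by
      linear_combination gen_relation_of_det_neg_one (F := F) (hσ k) - _ ^ 2 * h)) (N k)
  choose w₁ w₂ w₃ w₄ hw using hM
  choose v₁ v₂ v₃ v₄ hv using hN
  have hA := splitRot_mem_range (F := F) hτ hσ
  have hX := splitRefl_mem_range (F := F) hτ hσ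
  have key := central_mem_range hτ hσ h2 hτ' hσ'
  suffices (y, M, N) ∈ (splitHom F τ σ hτ hσ).range from this
  convert add_mem (add_mem (add_mem (key ((y 0 + y 1) / 2) ((y 2 + y 3) / 2) w₁ v₁)
    (mul_mem (key 0 0 w₂ v₂) hA))
    (mul_mem (key ((y 0 - y 1) / 2) ((y 2 - y 3) / 2) w₃ v₃) hX))
    (mul_mem (key 0 0 w₄ v₄) (mul_mem hA hX)) using 1
  refine Prod.ext ?_ (Prod.ext ?_ ?_)
  · funext i
    simp only [Prod.fst_add, Prod.fst_mul, Pi.add_apply, Pi.mul_apply, splitRot, splitRefl]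
    fin_cases i <;> simp <;> field_simp <;> ring
  · funext i
    exact (hw i).symm
  · funext k
    exact (hv k).symm

end SplitAlgebra

section Units

variable {F Ω ι κ : Type*} [Field F] [Field Ω] [Algebra F Ω] {τ : ι → Ω} {σ : κ → Ω}

theorem finrank_splitAlgebra [Fintype ι] [Fintype κ] [Algebra.IsAlgebraic F Ω] :
    Module.finrank F (SplitAlgebra F τ σ) = 4 + 4 * ∑ i, (minpoly F (τ i)).natDegree
      + 4 * ∑ k, (minpoly F (σ k)).natDegree := by
  have hint (t : Ω) : IsIntegral F t := Algebra.IsIntegral.isIntegral t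
  have (t : Ω) : FiniteDimensional F F⟮t⟯ := adjoin.finiteDimensional (hint t)
  rw [Module.finrank_prod, Module.finrank_prod, Module.finrank_pi, Module.finrank_pi_fintype,
    Module.finrank_pi_fintype]
  simp only [Module.finrank_matrix, adjoin.finrank (hint _), Fintype.card_fin, ← Finset.mul_sum]
  ring

/-- The unit group of the group algebra in odd characteristic, in terms of a set of
representatives of the conjugacy classes of character values. -/
theorem nonempty_units_mulEquiv [Fintype ι] [Fintype κ] [Algebra.IsAlgebraic F Ω]
    (h2 : (2 : F) ≠ 0)
    (hτ : ∀ i, τ i * (τ i ^ 2 - 2) = 0) (hσ : ∀ k, σ k ^ 4 + 4 * σ k ^ 2 + 2 = 0)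
    (hτ' : Function.Injective fun i => minpoly F (τ i))
    (hσ' : Function.Injective fun k => minpoly F (σ k))
    (hτd : ∑ i, (minpoly F (τ i)).natDegree = 3) (hσd : ∑ k, (minpoly F (σ k)).natDegree = 4) :
    Nonempty ((MonoidAlgebra F QuasidihedralThirtyTwo)ˣ ≃* (Fin 4 → Fˣ) ×
      (∀ i, Matrix.GeneralLinearGroup (Fin 2) F⟮τ i⟯) ×
      (∀ k, Matrix.GeneralLinearGroup (Fin 2) F⟮σ k⟯)) := by
  have (t : Ω) : FiniteDimensional F F⟮t⟯ :=
    adjoin.finiteDimensional (Algebra.IsIntegral.isIntegral t)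
  have : Module.Finite F (MonoidAlgebra F QuasidihedralThirtyTwo) :=
    Module.finite_of_finrank_pos (by rw [finrank_monoidAlgebra]; norm_num)
  have hM (t : Ω) : Module.Finite F (Matrix (Fin 2) (Fin 2) F⟮t⟯) := Module.Finite.matrix
  have : FiniteDimensional F (SplitAlgebra F τ σ) := Module.Finite.prod
  have hsurj := splitHom_surjective hτ hσ h2 hτ' hσ'
  have hinj : Function.Injective (splitHom F τ σ hτ hσ) :=
    (LinearMap.injective_iff_surjective_of_finrank_eq_finrank
      (f := (splitHom F τ σ hτ hσ).toLinearMap)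
      (by rw [finrank_monoidAlgebra, finrank_splitAlgebra, hτd, hσd])).2 hsurj
  let e := (AlgEquiv.ofBijective (splitHom F τ σ hτ hσ) ⟨hinj, hsurj⟩).toMulEquiv
  exact ⟨(Units.mapEquiv e).trans <| MulEquiv.prodUnits.trans <| MulEquiv.piUnits.prodCongr <|
    MulEquiv.prodUnits.trans <| MulEquiv.piUnits.prodCongr MulEquiv.piUnits⟩

end Units

section FiniteField

variable {F Ω : Type*} [Field F] [Finite F] [Field Ω] [Algebra F Ω]

theorem pow_card_pow_natDegree_minpoly {t : Ω} (ht : IsIntegral F t) :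
    t ^ Nat.card F ^ (minpoly F t).natDegree = t := by
  have := adjoin.finiteDimensional ht
  have : Finite F⟮t⟯ := Module.finite_of_finite F
  have := Fintype.ofFinite F⟮t⟯
  have h := FiniteField.pow_card (AdjoinSimple.gen F t)
  rw [← Nat.card_eq_fintype_card, Module.natCard_eq_pow_finrank (K := F), adjoin.finrank ht] at h
  have h' := congrArg (algebraMap F⟮t⟯ Ω) h
  rwa [map_pow, AdjoinSimple.algebraMap_gen] at h'

theorem mem_range_of_pow_card {t : Ω} (ht : t ^ Nat.card F = t) : t ∈ (algebraMap F Ω).range := by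
  have := Fintype.ofFinite F
  rw [Nat.card_eq_fintype_card] at ht
  have hdeg := FiniteField.X_pow_card_sub_X_natDegree_eq F (Fintype.one_lt_card (α := F))
  have hroots := FiniteField.roots_X_pow_card_sub_X F
  have hprod := prod_multiset_X_sub_C_of_monic_of_roots_card_eq
    (monic_X_pow_sub (n := Fintype.card F) (p := (X : F[X]))
      (by rw [degree_X]; exact_mod_cast Fintype.one_lt_card))
    (by rw [hroots, hdeg]; rfl)
  have h0 : aeval t (X ^ Fintype.card F - X : F[X]) = 0 := by simp [ht]
  rw [← hprod, map_multiset_prod, Multiset.prod_eq_zero_iff, Multiset.map_map,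
    Multiset.mem_map] at h0
  obtain ⟨c, -, hc⟩ := h0
  refine ⟨c, ?_⟩
  exact (sub_eq_zero.1 (by simpa using hc)).symm

/-- General linear groups over finite fields of the same cardinality are isomorphic. -/
theorem nonempty_generalLinearGroup_mulEquiv {K L : Type*} [Field K] [Field L] [Finite K]
    (h : Nat.card K = Nat.card L) : Nonempty (Matrix.GeneralLinearGroup (Fin 2) K ≃*
      Matrix.GeneralLinearGroup (Fin 2) L) := by
  have : Finite L := Nat.finite_of_card_ne_zero (h ▸ Nat.card_pos.ne')
  have := Fintype.ofFinite K
  have := Fintype.ofFinite L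
  exact ⟨Units.mapEquiv (FiniteField.ringEquivOfCardEq (K := K) (K' := L)
    (by rwa [← Nat.card_eq_fintype_card, ← Nat.card_eq_fintype_card])).mapMatrix.toMulEquiv⟩

theorem nonempty_units_mulEquiv_zmod {F : Type*} [Field F] [Finite F] :
    Nonempty (Fˣ ≃* Multiplicative (ZMod (Nat.card F - 1))) := by
  have e := zmodCyclicMulEquiv (inferInstance : IsCyclic Fˣ)
  rw [Nat.card_units] at e
  exact ⟨e.symm⟩

end FiniteField

/-- The values `ζ² + ζ¹⁴`, `ζ + ζ⁷` and `ζ³ + ζ⁵` of the two-dimensional characters, for a primitive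
sixteenth root of unity `ζ`, and the action of Frobenius on them. -/
theorem exists_character_values {Ω : Type*} [Field Ω] [IsAlgClosed Ω] (p n : ℕ) [Fact p.Prime]
    [CharP Ω p] : ∃ s t u : Ω, s ^ 2 = 2 ∧ t ^ 2 = s - 2 ∧ u ^ 2 = -s - 2 ∧
      (p ^ n % 16 = 1 ∨ p ^ n % 16 = 7 → s ^ p ^ n = s ∧ t ^ p ^ n = t ∧ u ^ p ^ n = u) ∧
      (p ^ n % 16 = 15 ∨ p ^ n % 16 = 9 → s ^ p ^ n = s ∧ t ^ p ^ n = -t ∧ u ^ p ^ n = -u) ∧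
      (p ^ n % 16 = 3 ∨ p ^ n % 16 = 13 ∨ p ^ n % 16 = 5 ∨ p ^ n % 16 = 11 →
        s ^ p ^ n = -s ∧ (t ^ p ^ n = u ∨ t ^ p ^ n = -u) ∧ (t ^ p ^ n) ^ p ^ n = -t) := by
  obtain ⟨ζ, hζ⟩ := IsAlgClosed.exists_pow_nat_eq (-1 : Ω) (n := 8) (by norm_num)
  have h16 : ζ ^ 16 = 1 := by rw [show 16 = 8 * 2 from rfl, pow_mul, hζ]; norm_num
  have hpow (m k : ℕ) (h : m % 16 = k) : ζ ^ m = ζ ^ k := by rw [pow_eq_pow_mod m h16, h]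
  have hneg (m k : ℕ) (h : m % 16 = 8 + k) : ζ ^ m = -ζ ^ k := by
    rw [hpow m _ h, pow_add, hζ, neg_one_mul]
  have hF (r i j : ℕ) (h : p ^ n % 16 = r) : (ζ ^ i + ζ ^ j) ^ p ^ n = ζ ^ (r * i) + ζ ^ (r * j) := by
    rw [add_pow_char_pow, ← pow_mul, ← pow_mul, mul_comm i, mul_comm j, pow_mul ζ, pow_mul ζ,
      hpow _ r h, ← pow_mul, ← pow_mul]
  refine ⟨ζ ^ 2 + ζ ^ 14, ζ ^ 1 + ζ ^ 7, ζ ^ 3 + ζ ^ 5, ?_, ?_, ?_, ?_, ?_, ?_⟩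
  · linear_combination (ζ ^ 4 + 2 * ζ ^ 8 - 2 + ζ ^ 20 - ζ ^ 12) * hζ
  · linear_combination 2 * hζ
  · linear_combination (2 + ζ ^ 2 + ζ ^ 6) * hζ
  · rintro (h | h) <;> refine ⟨?_, ?_, ?_⟩
    · rw [hF _ _ _ h, hpow (1 * 2) 2 rfl, hpow (1 * 14) 14 rfl]
    · rw [hF _ _ _ h, hpow (1 * 1) 1 rfl, hpow (1 * 7) 7 rfl]
    · rw [hF _ _ _ h, hpow (1 * 3) 3 rfl, hpow (1 * 5) 5 rfl]
    · rw [hF _ _ _ h, hpow (7 * 2) 14 rfl, hpow (7 * 14) 2 rfl, add_comm]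
    · rw [hF _ _ _ h, hpow (7 * 1) 7 rfl, hpow (7 * 7) 1 rfl, add_comm]
    · rw [hF _ _ _ h, hpow (7 * 3) 5 rfl, hpow (7 * 5) 3 rfl, add_comm]
  · rintro (h | h) <;> simp only [hF _ _ _ h] <;> refine ⟨?_, ?_, ?_⟩
    · rw [hpow (15 * 2) 14 rfl, hpow (15 * 14) 2 rfl, add_comm]
    · rw [hneg (15 * 1) 7 rfl, hneg (15 * 7) 1 rfl, neg_add_rev]
    · rw [hneg (15 * 3) 5 rfl, hneg (15 * 5) 3 rfl, neg_add_rev]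
    · rw [hpow (9 * 2) 2 rfl, hpow (9 * 14) 14 rfl]
    · rw [hneg (9 * 1) 1 rfl, hneg (9 * 7) 7 rfl, neg_add]
    · rw [hneg (9 * 3) 3 rfl, hneg (9 * 5) 5 rfl, neg_add]
  · rintro (h | h | h | h) <;> simp only [hF _ _ _ h] <;> refine ⟨?_, ?_, ?_⟩
    · rw [hpow (3 * 2) 6 rfl, hneg 14 6 rfl, hneg (3 * 14) 2 rfl]; ring
    · exact Or.inl (by rw [hpow (3 * 1) 3 rfl, hpow (3 * 7) 5 rfl])
    · rw [hneg (3 * (3 * 1)) 1 rfl, hneg (3 * (3 * 7)) 7 rfl, neg_add]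
    · rw [hneg (13 * 2) 2 rfl, hneg 14 6 rfl, hpow (13 * 14) 6 rfl]; ring
    · exact Or.inr (by rw [hneg (13 * 1) 5 rfl, hneg (13 * 7) 3 rfl, neg_add_rev])
    · rw [hneg (13 * (13 * 1)) 1 rfl, hneg (13 * (13 * 7)) 7 rfl, neg_add]
    · rw [hneg (5 * 2) 2 rfl, hneg 14 6 rfl, hpow (5 * 14) 6 rfl]; ring
    · exact Or.inl (by rw [hpow (5 * 1) 5 rfl, hpow (5 * 7) 3 rfl, add_comm])
    · rw [hneg (5 * (5 * 1)) 1 rfl, hneg (5 * (5 * 7)) 7 rfl, neg_add]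
    · rw [hpow (11 * 2) 6 rfl, hneg 14 6 rfl, hneg (11 * 14) 2 rfl]; ring
    · exact Or.inr (by rw [hneg (11 * 1) 3 rfl, hneg (11 * 7) 5 rfl, neg_add])
    · rw [hneg (11 * (11 * 1)) 1 rfl, hneg (11 * (11 * 7)) 7 rfl, neg_add]

section Degrees

variable {F Ω : Type*} [Field F] [Field Ω] [Algebra F Ω]

theorem injective_minpoly_of_mem_range {ι : Type*} {τ : ι → Ω}
    (h : ∀ i, τ i ∈ (algebraMap F Ω).range) (hinj : Function.Injective τ) :
    Function.Injective fun i => minpoly F (τ i) := by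
  intro i j hij
  obtain ⟨c, hc⟩ := h j
  refine hinj ?_
  rw [← hc]
  exact eq_algebraMap_of_minpoly_eq (by rw [hc]; exact hij)

theorem natDegree_minpoly_of_mem_range {t : Ω} (h : t ∈ (algebraMap F Ω).range) :
    (minpoly F t).natDegree = 1 := by
  obtain ⟨c, rfl⟩ := h
  rw [minpoly.eq_X_sub_C, natDegree_X_sub_C]

theorem natDegree_minpoly_of_sq_mem_range [Finite F] {t : Ω}
    (h : t ^ 2 ∈ (algebraMap F Ω).range) (ht : t ^ Nat.card F ≠ t) :
    (minpoly F t).natDegree = 2 := by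
  obtain ⟨c, hc⟩ := h
  have hmon : (X ^ 2 - C c).Monic := monic_X_pow_sub_C c two_ne_zero
  have h0 : aeval t (X ^ 2 - C c) = 0 := by simp [hc]
  have hint : IsIntegral F t := ⟨_, hmon, h0⟩
  have hle := natDegree_le_natDegree (minpoly.min F t hmon h0)
  rw [natDegree_X_pow_sub_C] at hle
  have hpos := minpoly.natDegree_pos hint
  have hne : (minpoly F t).natDegree ≠ 1 := fun h1 => ht (by
    have := pow_card_pow_natDegree_minpoly hint
    rwa [h1, pow_one] at this)
  omega

theorem natDegree_minpoly_eq_four [Finite F] {t : Ω} (h : t ^ 4 + 4 * t ^ 2 + 2 = 0)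
    (h1 : t ^ Nat.card F ≠ t) (h2 : t ^ Nat.card F ^ 2 ≠ t) (h3 : t ^ Nat.card F ^ 3 ≠ t) :
    (minpoly F t).natDegree = 4 := by
  have hmon : (X ^ 4 + 4 * X ^ 2 + 2 : F[X]).Monic := by monicity!
  have hdeg : (X ^ 4 + 4 * X ^ 2 + 2 : F[X]).natDegree = 4 := by compute_degree!
  have h0 : aeval t (X ^ 4 + 4 * X ^ 2 + 2 : F[X]) = 0 := by simpa [map_ofNat] using h
  have hint : IsIntegral F t := ⟨_, hmon, h0⟩
  have hle := natDegree_le_natDegree (minpoly.min F t hmon h0)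
  rw [hdeg] at hle
  have hpos := minpoly.natDegree_pos hint
  have hF := pow_card_pow_natDegree_minpoly hint
  generalize (minpoly F t).natDegree = d at *
  interval_cases d
  · exact absurd (by rwa [pow_one] at hF) h1
  · exact absurd hF h2
  · exact absurd hF h3
  · rfl

end Degrees

/-- The direct product of two powers of a group. -/
def powProdMulEquiv (G : Type*) [Group G] (m n : ℕ) :
    (Fin m → G) × (Fin n → G) ≃* (Fin (m + n) → G) where
  toEquiv := (Equiv.sumArrowEquivProdArrow _ _ G).symm.trans
    (Equiv.arrowCongr finSumFinEquiv (Equiv.refl G))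
  map_mul' f g := by
    funext i
    refine Fin.addCases (fun j => ?_) (fun j => ?_) i <;> simp <;> rfl

theorem exponent_ne_zero {p n : ℕ} {F : Type*} [Field F] [Finite F] (hF : Nat.card F = p ^ n) : n ≠ 0 := by
  rintro rfl
  exact absurd (Finite.one_lt_card (α := F)) (by rw [hF, pow_zero]; exact lt_irrefl 1)

theorem quartic_eq_zero {K : Type*} [Field K] {s t : K} (hs : s ^ 2 = 2) (ht : t ^ 2 = s - 2) :
    t ^ 4 + 4 * t ^ 2 + 2 = 0 := by
  linear_combination (t ^ 2 + 2 + s) * ht + hs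

theorem ne_zero_of_quartic_eq_zero {K : Type*} [Field K] (h2 : (2 : K) ≠ 0) {t : K}
    (ht : t ^ 4 + 4 * t ^ 2 + 2 = 0) : t ≠ 0 := by
  rintro rfl
  exact h2 (by linear_combination ht)

theorem ne_zero_of_sq_eq_two {K : Type*} [Field K] (h2 : (2 : K) ≠ 0) {s : K}
    (hs : s ^ 2 = 2) : s ≠ 0 := by
  rintro rfl
  exact h2 (by linear_combination -hs)

theorem ne_neg_self_of_ne_zero {K : Type*} [Field K] (h2 : (2 : K) ≠ 0) {t : K} (ht : t ≠ 0) :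
    t ≠ -t := fun h => mul_ne_zero h2 ht (by linear_combination h)

theorem two_ne_zero_algebraicClosure {F : Type*} [Field F] (h2 : (2 : F) ≠ 0) : (2 : AlgebraicClosure F) ≠ 0 := by
  rw [← map_ofNat (algebraMap F _) 2]
  exact (_root_.map_ne_zero _).2 h2

section Cases

variable {p n : ℕ} [Fact p.Prime] {F : Type*} [Field F] [Finite F]

theorem charP_of_card (hF : Nat.card F = p ^ n) : CharP F p := by
  have := Fintype.ofFinite F
  rw [Nat.card_eq_fintype_card] at hF
  exact charP_of_card_eq_prime_pow hF

theorem two_ne_zero_of_card (hp : 2 < p) (hF : Nat.card F = p ^ n) : (2 : F) ≠ 0 := by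
  have := charP_of_card hF
  intro h
  have h2 : ((2 : ℕ) : F) = 0 := by exact_mod_cast h
  exact absurd (Nat.le_of_dvd two_pos ((CharP.cast_eq_zero_iff F p 2).1 h2)) (by omega)

/-- The general linear group over the field generated by an element of degree `d`. -/
theorem nonempty_generalLinearGroup_adjoin {Ω : Type*} [Field Ω] [Algebra F Ω]
    [Algebra.IsAlgebraic F Ω] {K : Type*} [Field K] {d : ℕ} {t : Ω}
    (hK : Nat.card K = Nat.card F ^ d) (ht : (minpoly F t).natDegree = d) :
    Nonempty (Matrix.GeneralLinearGroup (Fin 2) F⟮t⟯ ≃* Matrix.GeneralLinearGroup (Fin 2) K) := by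
  have hint : IsIntegral F t := Algebra.IsIntegral.isIntegral t
  have := adjoin.finiteDimensional hint
  have : Finite F⟮t⟯ := Module.finite_of_finite F
  refine nonempty_generalLinearGroup_mulEquiv ?_
  rw [hK, Module.natCard_eq_pow_finrank (K := F), adjoin.finrank hint, ht]

theorem card_galoisField (hF : Nat.card F = p ^ n) {d : ℕ} (hd : d ≠ 0) :
    Nat.card (GaloisField p (d * n)) = Nat.card F ^ d := by
  rw [GaloisField.card p _ (mul_ne_zero hd (exponent_ne_zero hF)), hF, ← pow_mul, mul_comm]

theorem nonempty_units_mulEquiv_of_one_or_seven (hp : 2 < p) (hF : Nat.card F = p ^ n)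
    (hq : p ^ n % 16 = 1 ∨ p ^ n % 16 = 7) :
    Nonempty ((MonoidAlgebra F QuasidihedralThirtyTwo)ˣ ≃* (Fin 4 → Fˣ) ×
      (Fin 7 → Matrix.GeneralLinearGroup (Fin 2) F)) := by
  have h2 := two_ne_zero_of_card hp hF
  have h2' := two_ne_zero_algebraicClosure h2
  have := charP_of_card hF
  have : CharP (AlgebraicClosure F) p := charP_of_injective_algebraMap' F p
  obtain ⟨s, t, u, hs, ht, hu, h, -, -⟩ :=
    exists_character_values (Ω := AlgebraicClosure F) p n
  obtain ⟨hsq, htq, huq⟩ := h hq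
  rw [← hF] at hsq htq huq
  have hs' := mem_range_of_pow_card hsq
  have ht' := mem_range_of_pow_card htq
  have hu' := mem_range_of_pow_card huq
  have hs0 := ne_zero_of_sq_eq_two h2' hs
  have ht4 := quartic_eq_zero hs ht
  have hu4 := quartic_eq_zero ((neg_sq s).trans hs) hu
  have htt := ne_neg_self_of_ne_zero h2' (ne_zero_of_quartic_eq_zero h2' ht4)
  have huu := ne_neg_self_of_ne_zero h2' (ne_zero_of_quartic_eq_zero h2' hu4)
  have hss := ne_neg_self_of_ne_zero h2' hs0
  have htu : t ^ 2 ≠ u ^ 2 := fun h => mul_ne_zero h2' hs0 (by linear_combination h - ht + hu)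
  have htu₁ : t ≠ u := fun h => htu (by rw [h])
  have htu₂ : t ≠ -u := fun h => htu (by rw [h, neg_sq])
  have htu₃ : -t ≠ u := fun h => htu (by rw [← h, neg_sq])
  have hτr : ∀ i, (![0, s, -s] : Fin 3 → AlgebraicClosure F) i ∈ (algebraMap F _).range := by
    intro i
    fin_cases i
    · exact zero_mem _
    · exact hs'
    · exact neg_mem hs'
  have hσr : ∀ i, (![t, -t, u, -u] : Fin 4 → AlgebraicClosure F) i ∈ (algebraMap F _).range := by
    intro i
    fin_cases i
    · exact ht'
    · exact neg_mem ht'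
    · exact hu'
    · exact neg_mem hu'
  have hτi : Function.Injective (![0, s, -s] : Fin 3 → AlgebraicClosure F) := by
    intro i j h
    fin_cases i <;> fin_cases j <;> simp_all
  have hσi : Function.Injective (![t, -t, u, -u] : Fin 4 → AlgebraicClosure F) := by
    intro i j h
    fin_cases i <;> fin_cases j <;>
      simp [htt, htt.symm, huu, huu.symm, htu₁, htu₁.symm, htu₂, htu₂.symm, htu₃, htu₃.symm] at h ⊢
  obtain ⟨e⟩ := nonempty_units_mulEquiv (τ := ![0, s, -s]) (σ := ![t, -t, u, -u]) h2
    (by intro i; fin_cases i <;> simp [hs])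
    (by
      intro i
      fin_cases i
      · exact ht4
      · exact quartic_eq_zero hs ((neg_sq t).trans ht)
      · exact hu4
      · exact quartic_eq_zero ((neg_sq s).trans hs) ((neg_sq u).trans hu))
    (injective_minpoly_of_mem_range hτr hτi) (injective_minpoly_of_mem_range hσr hσi)
    (by simp only [natDegree_minpoly_of_mem_range (hτr _)]; simp)
    (by simp only [natDegree_minpoly_of_mem_range (hσr _)]; simp)
  have hcard : Nat.card F = Nat.card F ^ 1 := (pow_one _).symm
  have e₁ i := (nonempty_generalLinearGroup_adjoin hcard
    (natDegree_minpoly_of_mem_range (hτr i))).some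
  have e₂ i := (nonempty_generalLinearGroup_adjoin hcard
    (natDegree_minpoly_of_mem_range (hσr i))).some
  exact ⟨e.trans <| (MulEquiv.refl _).prodCongr <|
    ((MulEquiv.piCongrRight e₁).prodCongr (MulEquiv.piCongrRight e₂)).trans
      (powProdMulEquiv _ 3 4)⟩

theorem nonempty_units_mulEquiv_of_neg_one_or_neg_seven (hp : 2 < p) (hF : Nat.card F = p ^ n)
    (hq : p ^ n % 16 = 15 ∨ p ^ n % 16 = 9) :
    Nonempty ((MonoidAlgebra F QuasidihedralThirtyTwo)ˣ ≃* (Fin 4 → Fˣ) ×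
      (Fin 3 → Matrix.GeneralLinearGroup (Fin 2) F) ×
      (Fin 2 → Matrix.GeneralLinearGroup (Fin 2) (GaloisField p (2 * n)))) := by
  have h2 := two_ne_zero_of_card hp hF
  have h2' := two_ne_zero_algebraicClosure h2
  have := charP_of_card hF
  have : CharP (AlgebraicClosure F) p := charP_of_injective_algebraMap' F p
  obtain ⟨s, t, u, hs, ht, hu, -, h, -⟩ :=
    exists_character_values (Ω := AlgebraicClosure F) p n
  obtain ⟨hsq, htq, huq⟩ := h hq
  rw [← hF] at hsq htq huq
  have hs' := mem_range_of_pow_card hsq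
  have h2r : (2 : AlgebraicClosure F) ∈ (algebraMap F (AlgebraicClosure F)).range :=
    ⟨2, map_ofNat _ 2⟩
  have ht' : t ^ 2 ∈ (algebraMap F (AlgebraicClosure F)).range := by
    rw [ht]; exact sub_mem hs' h2r
  have hu' : u ^ 2 ∈ (algebraMap F (AlgebraicClosure F)).range := by
    rw [hu]; exact sub_mem (neg_mem hs') h2r
  have hs0 := ne_zero_of_sq_eq_two h2' hs
  have ht4 := quartic_eq_zero hs ht
  have hu4 := quartic_eq_zero ((neg_sq s).trans hs) hu
  have htt := ne_neg_self_of_ne_zero h2' (ne_zero_of_quartic_eq_zero h2' ht4)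
  have huu := ne_neg_self_of_ne_zero h2' (ne_zero_of_quartic_eq_zero h2' hu4)
  have hss := ne_neg_self_of_ne_zero h2' hs0
  have htu : t ^ 2 ≠ u ^ 2 := fun h => mul_ne_zero h2' hs0 (by linear_combination h - ht + hu)
  have hτr : ∀ i, (![0, s, -s] : Fin 3 → AlgebraicClosure F) i ∈ (algebraMap F _).range := by
    intro i
    fin_cases i
    · exact zero_mem _
    · exact hs'
    · exact neg_mem hs'
  have hτi : Function.Injective (![0, s, -s] : Fin 3 → AlgebraicClosure F) := by
    intro i j h
    fin_cases i <;> fin_cases j <;> simp_all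
  have hσd : ∀ i, (minpoly F ((![t, u] : Fin 2 → AlgebraicClosure F) i)).natDegree = 2 := by
    intro i
    fin_cases i
    · exact natDegree_minpoly_of_sq_mem_range ht' (htq.trans_ne htt.symm)
    · exact natDegree_minpoly_of_sq_mem_range hu' (huq.trans_ne huu.symm)
  have htu' : minpoly F t ≠ minpoly F u := fun h => by
    obtain ⟨c, hc⟩ := ht'
    have h0 : aeval t (X ^ 2 - C c) = 0 := by simp [hc]
    obtain ⟨R, hR⟩ := minpoly.dvd F t h0
    have h1 : aeval u (X ^ 2 - C c) = 0 := by rw [hR, h, map_mul, minpoly.aeval, zero_mul]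
    refine htu ?_
    rw [← hc]
    exact (sub_eq_zero.1 (by simpa using h1)).symm
  have hσi : Function.Injective fun i => minpoly F ((![t, u] : Fin 2 → AlgebraicClosure F) i) := by
    intro i j h
    fin_cases i <;> fin_cases j
    · rfl
    · exact absurd h htu'
    · exact absurd h.symm htu'
    · rfl
  obtain ⟨e⟩ := nonempty_units_mulEquiv (τ := ![0, s, -s]) (σ := ![t, u]) h2
    (by intro i; fin_cases i <;> simp [hs])
    (by
      intro i
      fin_cases i
      · exact ht4
      · exact hu4)
    (injective_minpoly_of_mem_range hτr hτi) hσi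
    (by simp only [natDegree_minpoly_of_mem_range (hτr _)]; simp)
    (by simp only [hσd]; simp)
  have e₁ i := (nonempty_generalLinearGroup_adjoin (pow_one (Nat.card F)).symm
    (natDegree_minpoly_of_mem_range (hτr i))).some
  have e₂ i := (nonempty_generalLinearGroup_adjoin (card_galoisField hF two_ne_zero) (hσd i)).some
  exact ⟨e.trans <| (MulEquiv.refl _).prodCongr <|
    (MulEquiv.piCongrRight e₁).prodCongr (MulEquiv.piCongrRight e₂)⟩

theorem nonempty_units_mulEquiv_of_three_or_five (hp : 2 < p) (hF : Nat.card F = p ^ n)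
    (hq : p ^ n % 16 = 3 ∨ p ^ n % 16 = 13 ∨ p ^ n % 16 = 5 ∨ p ^ n % 16 = 11) :
    Nonempty ((MonoidAlgebra F QuasidihedralThirtyTwo)ˣ ≃* (Fin 4 → Fˣ) ×
      Matrix.GeneralLinearGroup (Fin 2) F ×
      Matrix.GeneralLinearGroup (Fin 2) (GaloisField p (2 * n)) ×
      Matrix.GeneralLinearGroup (Fin 2) (GaloisField p (4 * n))) := by
  have h2 := two_ne_zero_of_card hp hF
  have h2' := two_ne_zero_algebraicClosure h2
  have := charP_of_card hF
  have : CharP (AlgebraicClosure F) p := charP_of_injective_algebraMap' F p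
  obtain ⟨s, t, u, hs, ht, hu, -, -, h⟩ :=
    exists_character_values (Ω := AlgebraicClosure F) p n
  obtain ⟨hsq, htq, htqq⟩ := h hq
  have hodd : Odd (Nat.card F) := by rw [hF, Nat.odd_iff]; omega
  rw [← hF] at hsq htq htqq
  have hs0 := ne_zero_of_sq_eq_two h2' hs
  have ht4 := quartic_eq_zero hs ht
  have htt := ne_neg_self_of_ne_zero h2' (ne_zero_of_quartic_eq_zero h2' ht4)
  have hss := ne_neg_self_of_ne_zero h2' hs0
  have htu : t ^ 2 ≠ u ^ 2 := fun h => mul_ne_zero h2' hs0 (by linear_combination h - ht + hu)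
  have htsq : (t ^ Nat.card F) ^ 2 = u ^ 2 := by
    rcases htq with h | h <;> rw [h]
    exact neg_sq u
  have hsd : (minpoly F s).natDegree = 2 :=
    natDegree_minpoly_of_sq_mem_range ⟨2, by rw [hs, map_ofNat]⟩ (by rw [hsq]; exact hss.symm)
  have htd : (minpoly F t).natDegree = 4 := by
    refine natDegree_minpoly_eq_four ht4 (fun h => htu (by rw [← htsq, h])) (fun h => htt ?_)
      (fun h => htu ?_)
    · rwa [sq, pow_mul, htqq, eq_comm] at h
    · rw [pow_succ, pow_mul, sq (Nat.card F), pow_mul, htqq, hodd.neg_pow] at h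
      rw [← htsq, ← neg_sq (t ^ Nat.card F), h]
  have h0d : (minpoly F (0 : AlgebraicClosure F)).natDegree = 1 :=
    natDegree_minpoly_of_mem_range (zero_mem _)
  have hs0' : minpoly F s ≠ minpoly F (0 : AlgebraicClosure F) := fun h => by
    rw [h, h0d] at hsd
    exact absurd hsd (by norm_num)
  have hτi : Function.Injective fun i => minpoly F ((![0, s] : Fin 2 → AlgebraicClosure F) i) := by
    intro i j h
    fin_cases i <;> fin_cases j
    · rfl
    · exact absurd h.symm hs0'
    · exact absurd h hs0'
    · rfl
  obtain ⟨e⟩ := nonempty_units_mulEquiv (τ := ![0, s]) (σ := fun _ : Unit => t) h2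
    (by intro i; fin_cases i <;> simp [hs]) (fun _ => ht4) hτi
    (Function.injective_of_subsingleton _) (by simp [Fin.sum_univ_two, hsd]) (by simp [htd])
  obtain ⟨e₁⟩ := nonempty_generalLinearGroup_adjoin (pow_one (Nat.card F)).symm h0d
  obtain ⟨e₂⟩ := nonempty_generalLinearGroup_adjoin (card_galoisField hF two_ne_zero) hsd
  obtain ⟨e₃⟩ := nonempty_generalLinearGroup_adjoin (card_galoisField hF four_ne_zero) htd
  let f : (∀ i, Matrix.GeneralLinearGroup (Fin 2) F⟮(![0, s] : Fin 2 → AlgebraicClosure F) i⟯) ≃*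
      Matrix.GeneralLinearGroup (Fin 2) F⟮(0 : AlgebraicClosure F)⟯ ×
      Matrix.GeneralLinearGroup (Fin 2) F⟮s⟯ :=
    { piFinTwoEquiv _ with map_mul' := fun _ _ => rfl }
  exact ⟨e.trans <| (MulEquiv.refl _).prodCongr <|
    ((f.trans (e₁.prodCongr e₂)).prodCongr ((MulEquiv.piUnique _).trans e₃)).trans
      MulEquiv.prodAssoc⟩

end Cases

end QuasidihedralThirtyTwo

end Auxiliary

theorem theorem2 (p n q : ℕ) [Fact p.Prime] (hq : q = p ^ n)
    (F : Type*) [Field F] [Finite F] (hF : Nat.card F = q) :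
    (p = 2 →
      Nonempty ((MonoidAlgebra F QuasidihedralThirtyTwo)ˣ ⧸
          oneAddJacobson (MonoidAlgebra F QuasidihedralThirtyTwo) ≃*
        Multiplicative (ZMod (q - 1))) ∧
      IsPGroup 2 (oneAddJacobson (MonoidAlgebra F QuasidihedralThirtyTwo)) ∧
      Nat.card (oneAddJacobson (MonoidAlgebra F QuasidihedralThirtyTwo)) = 2 ^ (31 * n) ∧
      Monoid.exponent (oneAddJacobson (MonoidAlgebra F QuasidihedralThirtyTwo)) = 16) ∧
    (2 < p →
      (((q : ℤ) ≡ 1 [ZMOD 16] ∨ (q : ℤ) ≡ 7 [ZMOD 16]) →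
        Nonempty ((MonoidAlgebra F QuasidihedralThirtyTwo)ˣ ≃*
          (Fin 4 → Multiplicative (ZMod (q - 1))) ×
          (Fin 7 → Matrix.GeneralLinearGroup (Fin 2) F))) ∧
      (((q : ℤ) ≡ -1 [ZMOD 16] ∨ (q : ℤ) ≡ -7 [ZMOD 16]) →
        Nonempty ((MonoidAlgebra F QuasidihedralThirtyTwo)ˣ ≃*
          (Fin 4 → Multiplicative (ZMod (q - 1))) ×
          (Fin 3 → Matrix.GeneralLinearGroup (Fin 2) F) ×
          (Fin 2 → Matrix.GeneralLinearGroup (Fin 2) (GaloisField p (2 * n))))) ∧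
      (((q : ℤ) ≡ 3 [ZMOD 16] ∨ (q : ℤ) ≡ -3 [ZMOD 16] ∨
          (q : ℤ) ≡ 5 [ZMOD 16] ∨ (q : ℤ) ≡ -5 [ZMOD 16]) →
        Nonempty ((MonoidAlgebra F QuasidihedralThirtyTwo)ˣ ≃*
          (Fin 4 → Multiplicative (ZMod (q - 1))) ×
          Matrix.GeneralLinearGroup (Fin 2) F ×
          Matrix.GeneralLinearGroup (Fin 2) (GaloisField p (2 * n)) ×
          Matrix.GeneralLinearGroup (Fin 2) (GaloisField p (4 * n))))) := by
  open QuasidihedralThirtyTwo in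
  subst hq
  obtain ⟨eF⟩ := nonempty_units_mulEquiv_zmod (F := F)
  rw [hF] at eF
  refine ⟨?_, fun hp => ⟨fun h => ?_, fun h => ?_, fun h => ?_⟩⟩
  · rintro rfl
    have := charP_of_card hF
    have hcard : Nat.card (oneAddJacobson (MonoidAlgebra F QuasidihedralThirtyTwo))
        = 2 ^ (31 * n) := by
      rw [card_oneAddJacobson, hF, ← pow_mul, mul_comm]
    exact ⟨⟨((QuotientGroup.quotientMulEquivOfEq oneAddJacobson_eq_ker).trans
      (QuotientGroup.quotientKerEquivOfSurjective _ augmentationUnits_surjective)).trans eF⟩,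
      IsPGroup.of_card hcard, hcard, exponent_oneAddJacobson⟩
  · obtain ⟨e⟩ := nonempty_units_mulEquiv_of_one_or_seven (F := F) hp hF
      (by unfold Int.ModEq at h; omega)
    exact ⟨e.trans ((MulEquiv.piCongrRight fun _ => eF).prodCongr (MulEquiv.refl _))⟩
  · obtain ⟨e⟩ := nonempty_units_mulEquiv_of_neg_one_or_neg_seven (F := F) hp hF
      (by unfold Int.ModEq at h; omega)
    exact ⟨e.trans ((MulEquiv.piCongrRight fun _ => eF).prodCongr (MulEquiv.refl _))⟩
  · obtain ⟨e⟩ := nonempty_units_mulEquiv_of_three_or_five (F := F) hp hF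
      (by unfold Int.ModEq at h; omega)
    exact ⟨e.trans ((MulEquiv.piCongrRight fun _ => eF).prodCongr (MulEquiv.refl _))⟩
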